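/- Let $p$ be an odd prime, let $m, s$ be positive integers, and let $\mathcal{R} = \mathbb{F}_{p^m}[u,v]/\langle u^2, v^2, uv-vu\rangle = \mathbb{F}_{p^m}+u\mathbb{F}_{p^m}+v\mathbb{F}_{p^m}+uv\mathbb{F}_{p^m}$. Let $\alpha = \alpha_1+\alpha_3 v+\alpha_4 uv$ with $\alpha_1,\alpha_3\in\mathbb{F}_{p^m}\setminus\{0\}$ and $\alpha_4\in\mathbb{F}_{p^m}$, and suppose that $\alpha$ is not a square in $\mathcal{R}$. Let $r_0$ be the remainder of $s$ modulo $m$, and let $\alpha_0 = \alpha_1^{p^{m-r_0}}$, so that $\alpha_0^{p^s}=\alpha_1$. Identify a word $(c_0,\dots,c_{n-1})\in\mathcal{R}^n$ of length $n = 2p^s$ with the class of $c_0+c_1x+\cdots+c_{n-1}x^{n-1}$ in $\mathcal{R}[x]/\langle x^{2p^s}-\alpha\rangle$, so that the ideals of this ring are codes of length $n$ over $\mathcal{R}$. The symbol-pair distance of two words $a,b\in\mathcal{R}^n$ is the number of indices $i\in\{0,\dots,n-1\}$ with $(a_i,a_{i+1})\neq(b_i,b_{i+1})$, where indices are taken modulo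 $n$; the symbol-pair distance $d_{sp}(\mathcal{C})$ of a code $\mathcal{C}$ with at least two words is the least symbol-pair distance of two distinct words of $\mathcal{C}$. Let $0\le\ell\le 2p^s-1$ and let $\mathcal{C} = \langle u(x^2-\alpha_0)^\ell\rangle$ in $\mathcal{R}[x]/\langle x^{2p^s}-\alpha\rangle$. Then $$d_{sp}(\mathcal{C})=\begin{cases}2 & \text{if } 0\le\ell\le p^s,\\ 2(\Gamma+1)p^{\gamma} & \text{if } 2p^s-p^{s-\gamma}+(\Gamma-1)p^{s-\gamma-1}+1\le\ell\le 2p^s-p^{s-\gamma}+\Gamma p^{s-\gamma-1},\\ & \text{where } 1\le\Gamma\le p-1 \text{ and } 0\le\gamma\le s-1.\end{cases}$$ -/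

import Mathlib

open Polynomial

noncomputable section

/-- The ring `F[u, v] / ⟨u², v², uv - vu⟩ = F + uF + vF + uvF`. -/
abbrev UVRing (F : Type*) [Field F] : Type _ :=
  MvPolynomial (Fin 2) F ⧸
    (Ideal.span {MvPolynomial.X 0 ^ 2, MvPolynomial.X 1 ^ 2,
      MvPolynomial.X 0 * MvPolynomial.X 1 - MvPolynomial.X 1 * MvPolynomial.X 0} :
      Ideal (MvPolynomial (Fin 2) F))

/-- The element `u` of `F + uF + vF + uvF`. -/
def UVRing.u (F : Type*) [Field F] : UVRing F := Ideal.Quotient.mk _ (MvPolynomial.X 0)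

/-- The element `v` of `F + uF + vF + uvF`. -/
def UVRing.v (F : Type*) [Field F] : UVRing F := Ideal.Quotient.mk _ (MvPolynomial.X 1)

/-- The element `α₁ + α₃ v + α₄ uv` of `F + uF + vF + uvF`. -/
def uvAlpha {F : Type*} [Field F] (α₁ α₃ α₄ : F) : UVRing F :=
  algebraMap F (UVRing F) α₁ + algebraMap F (UVRing F) α₃ * UVRing.v F +
    algebraMap F (UVRing F) α₄ * (UVRing.u F * UVRing.v F)

/-- The element `α₀ = α₁ ^ (p ^ (m - r₀))`, where `r₀` is the remainder of `s` modulo `m`.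
In the field with `p ^ m` elements it is the root of `α₀ ^ (p ^ s) = α₁`. -/
def alphaZero {F : Type*} [Field F] (p m s : ℕ) (α₁ : F) : F := α₁ ^ p ^ (m - s % m)

/-- The ambient ring `A[x] / ⟨xⁿ - a⟩` of the `a`-constacyclic codes of length `n` over `A`. -/
abbrev ConstaRing (A : Type*) [CommRing A] (n : ℕ) (a : A) : Type _ :=
  A[X] ⧸ (Ideal.span {(X : A[X]) ^ n - C a} : Ideal A[X])

/-- The class of `c₀ + c₁ x + ⋯ + cₙ₋₁ xⁿ⁻¹` in `A[x] / ⟨xⁿ - a⟩`. -/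
def wordClass {A : Type*} [CommRing A] {n : ℕ} (a : A) (c : Fin n → A) : ConstaRing A n a :=
  Ideal.Quotient.mk _ (∑ i : Fin n, C (c i) * X ^ (i : ℕ))

/-- The code of length `n` over `A` that corresponds to an ideal of `A[x] / ⟨xⁿ - a⟩`. -/
def idealCode {A : Type*} [CommRing A] {n : ℕ} {a : A} (I : Ideal (ConstaRing A n a)) :
    Set (Fin n → A) :=
  {c | wordClass a c ∈ I}

open Classical in
/-- The symbol-pair distance: the number of indices `i` modulo `n` with
`(xᵢ, xᵢ₊₁) ≠ (yᵢ, yᵢ₊₁)`, where `finRotate n` is the map `i ↦ i + 1` modulo `n`. -/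
def symbolPairDist {A : Type*} {n : ℕ} (x y : Fin n → A) : ℕ :=
  hammingDist (fun i => (x i, x (finRotate n i))) (fun i => (y i, y (finRotate n i)))

/-- The symbol-pair distance of a code: the least distance of two distinct codewords
(`0` for a code with fewer than two codewords). -/
def codeSymbolPairDist {A : Type*} {n : ℕ} (K : Set (Fin n → A)) : ℕ :=
  sInf {d : ℕ | ∃ x ∈ K, ∃ y ∈ K, x ≠ y ∧ symbolPairDist x y = d}

/-- The ideal `⟨u (x² - α₀) ^ ℓ⟩` of `A[x] / ⟨x ^ (2 p ^ s) - α⟩`, where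
`A = F + uF + vF + uvF` and `α = α₁ + α₃ v + α₄ uv`. -/
def typeBIdeal {F : Type*} [Field F] (p m s : ℕ) (α₁ α₃ α₄ : F) (ℓ : ℕ) :
    Ideal (ConstaRing (UVRing F) (2 * p ^ s) (uvAlpha α₁ α₃ α₄)) :=
  Ideal.span {Ideal.Quotient.mk _
    (C (UVRing.u F) * (X ^ 2 - C (algebraMap F (UVRing F) (alphaZero p m s α₁))) ^ ℓ)}

end

/-! Write `n = 2 p^s`, `N = p^s`. Since `α₀ ^ N = α₁` and `u² = 0`, modulo `x^n - α` one has `u (x²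
- α₀)^N = u (α - α₁) = α₃ uv`. As `α₃` is a unit, `⟨u (x² - α₀)^(N + j)⟩` is generated by `uv (x² -
α₀)^j`. Both `u` and `v` kill `uv`, so for `j ≤ N` the code is a copy of the multiples `f` of `(x² -
α₀)^j` over `F` of degree below `n` (`mem_idealCode_iff`). If `ℓ ≤ N`, it contains the word `uv`, of
pair weight 2, the least possible.

For larger `ℓ`, split `f` into even and odd parts. Read in `x²`, each is a multiple of `(X - α₀)^j`
of degree below `N`. Positions of equal parity are not adjacent, so the pair weight of `f` is at
least twice the Hamming weight of either part; a polynomial in `x²` has pair weight at most twice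
its Hamming weight. What remains is the least Hamming weight of nonzero multiples of `(X - α₀)^j` of
degree below `N`, given by `weight_lower_bound` and `weight_upper_bound`: split off factors `(X^q -
α₀^q)^(p-1)`, each multiplying the weight by `p`. -/

/-! ### Hamming weights of multiples of `(X - a)^k` in characteristic `p` -/

section Weights

variable {F : Type*} [Field F]

/-- The operator `X f' - i f` removes the term of degree `i`. -/
theorem coeff_X_mul_derivative_sub (f : F[X]) (i n : ℕ) :
    (X * derivative f - C (i : F) * f).coeff n = ((n : F) - i) * f.coeff n := by
  cases n with
  | zero => simp
  | succ n => simp [coeff_X_mul, coeff_derivative]; ring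

/-- The operator `X f' - i f` deletes exactly the term of degree `i`, since the exponents are
distinct in `F`, and costs at most one factor `X - b`. The result is nonzero, because a monomial has
no root `b ≠ 0`; so one can induct on `k`. -/
theorem lt_card_support_of_pow_dvd {b : F} (hb : b ≠ 0) (k : ℕ) (f : F[X]) (hf : f ≠ 0)
    (hinj : Set.InjOn (Nat.cast : ℕ → F) f.support) (hdvd : (X - C b) ^ k ∣ f) :
    k < f.support.card := by
  induction k generalizing f with
  | zero => exact Finset.card_pos.mpr (nonempty_support_iff.mpr hf)
  | succ k ih =>
    obtain ⟨i, hi⟩ := nonempty_support_iff.mpr hf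
    set g := X * derivative f - C (i : F) * f with hg
    have hsupp : g.support = f.support.erase i := by
      ext n
      rw [mem_support_iff, hg, coeff_X_mul_derivative_sub, mul_ne_zero_iff, sub_ne_zero,
        Finset.mem_erase, mem_support_iff]
      refine and_congr_left fun hn => not_congr ⟨fun h => ?_, fun h => by rw [h]⟩
      exact hinj (mem_support_iff.mpr hn) hi h
    have hg0 : g ≠ 0 := by
      intro h0
      have hmono : f = monomial i (f.coeff i) := by
        ext n
        rw [coeff_monomial]
        split_ifs with h
        · rw [h]
        · by_contra hn
          have : n ∈ g.support := by
            rw [hsupp, Finset.mem_erase]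
            exact ⟨fun h' => h h'.symm, mem_support_iff.mpr hn⟩
          simp [h0] at this
      have hroot : f.eval b = 0 := by
        obtain ⟨c, hc⟩ := hdvd
        rw [hc]
        simp
      rw [hmono, eval_monomial] at hroot
      exact mul_ne_zero (mem_support_iff.mp hi) (pow_ne_zero _ hb) hroot
    have hgd : (X - C b) ^ k ∣ g := by
      refine dvd_sub (Dvd.dvd.mul_left ?_ _) (Dvd.dvd.mul_left ?_ _)
      · obtain ⟨c, rfl⟩ := hdvd
        rw [derivative_mul, derivative_X_sub_C_pow, Nat.add_sub_cancel]
        exact dvd_add ⟨C ((k + 1 : ℕ) : F) * c, by ring⟩ ⟨(X - C b) * derivative c, by ring⟩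
      · exact (pow_dvd_pow _ k.le_succ).trans hdvd
    have hlt := ih g hg0 (hinj.mono (by rw [hsupp]; exact_mod_cast Finset.erase_subset _ _)) hgd
    rw [hsupp, Finset.card_erase_of_mem hi] at hlt
    omega

theorem natCast_injOn_Icc (F : Type*) [Field F] (p : ℕ) [CharP F p] :
    Set.InjOn (Nat.cast : ℕ → F) (Set.Icc 1 p) := by
  have key : ∀ x y : ℕ, 1 ≤ x → y ≤ p → x ≤ y → (x : F) = y → x = y := by
    intro x y hx hy hxy h
    have h0 : ((y - x : ℕ) : F) = 0 := by rw [Nat.cast_sub hxy, h, sub_self]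
    rw [CharP.cast_eq_zero_iff F p] at h0
    have := Nat.eq_zero_of_dvd_of_lt h0 (by omega)
    omega
  intro x hx y hy h
  rcases le_total x y with hxy | hxy
  · exact key x y hx.1 hy.2 hxy h
  · exact (key y x hy.1 hx.2 hxy h.symm).symm

theorem X_sub_C_pow_char_pow {p : ℕ} [Fact p.Prime] [CharP F p] (a : F) (e : ℕ) :
    (X - C a) ^ p ^ e = (X ^ p ^ e - C (a ^ p ^ e) : F[X]) := by
  rw [sub_pow_char_pow, C_pow]

theorem X_sub_C_pow_char_pow_mul {p : ℕ} [Fact p.Prime] [CharP F p] (a : F) (e k : ℕ) :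
    (X - C a) ^ (p ^ e * k) = expand F (p ^ e) ((X - C (a ^ p ^ e)) ^ k) := by
  rw [pow_mul, X_sub_C_pow_char_pow]
  simp

/-- Sort the exponents by residue modulo `q = p^e`; one class gives `h`, a polynomial in `X^q` up to
a shift. If it is the only class, multiplicities are multiples of `q`, so `q k + 1` improves to `q
(k + 1)`. Otherwise `h` has at least `k + 1` terms and another class adds one. -/
theorem add_two_le_card_support {p : ℕ} [Fact p.Prime] [CharP F p] {a : F} (ha : a ≠ 0)
    (e k : ℕ) (f : F[X]) (hf : f ≠ 0) (hdeg : f.natDegree < p ^ (e + 1))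
    (hdvd : (X - C a) ^ (p ^ e * k + 1) ∣ f) : k + 2 ≤ f.support.card := by
  set q := p ^ e with hq
  have hp : p.Prime := Fact.out
  have hqpos : 0 < q := pow_pos hp.pos _
  obtain ⟨i₀, hi₀⟩ := nonempty_support_iff.mpr hf
  -- This shift makes the exponents congruent to `i₀` divisible by `q`. As `0 < t ≤ q`, the
  -- exponents of `h` lie in `[1, p]`, hence are distinct modulo `p`.
  set t := q - i₀ % q with ht
  have hmod : i₀ % q < q := Nat.mod_lt _ hqpos
  set h := contract q (X ^ t * f) with hh
  have hcoeff : ∀ n, h.coeff n = if t ≤ n * q then f.coeff (n * q - t) else 0 := by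
    intro n
    rw [hh, coeff_contract hqpos.ne', coeff_X_pow_mul']
  have hsub : ∀ n ∈ h.support, t ≤ n * q ∧ n * q - t ∈ f.support := by
    intro n hn
    rw [mem_support_iff, hcoeff] at hn
    split_ifs at hn with hle
    · exact ⟨hle, mem_support_iff.mpr hn⟩
    · exact absurd rfl hn
  have hres : ∀ n, t ≤ n * q → (n * q - t) % q = i₀ % q := by
    intro n hn
    have h1 : n * q - t = i₀ % q + q * (n - 1) := by
      have hn1 : n ≠ 0 := by rintro rfl; omega
      obtain ⟨m, rfl⟩ := Nat.exists_eq_succ_of_ne_zero hn1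
      simp only [Nat.succ_eq_add_one, Nat.add_sub_cancel] at *
      rw [add_mul, mul_comm q m]
      omega
    rw [h1, Nat.add_mul_mod_self_left, Nat.mod_mod]
  have hi₀t : (i₀ / q + 1) * q - t = i₀ ∧ t ≤ (i₀ / q + 1) * q := by
    have := Nat.div_add_mod i₀ q
    rw [add_mul, mul_comm (i₀ / q)]
    omega
  have hh0 : h ≠ 0 := by
    intro h0
    have := hcoeff (i₀ / q + 1)
    rw [if_pos hi₀t.2, hi₀t.1, h0, coeff_zero] at this
    exact mem_support_iff.mp hi₀ this.symm
  have hinj : Set.InjOn (Nat.cast : ℕ → F) h.support := by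
    refine (natCast_injOn_Icc F p).mono fun n hn => ?_
    obtain ⟨hle, hn⟩ := hsub n hn
    have h1 := le_natDegree_of_mem_supp _ hn
    refine ⟨Nat.pos_of_ne_zero ?_, ?_⟩
    · rintro rfl; omega
    · have : n * q < (p + 1) * q := by
        rw [pow_succ, ← hq, mul_comm] at hdeg
        rw [add_mul]; omega
      exact Nat.lt_succ_iff.mp (lt_of_mul_lt_mul_right this (Nat.zero_le _))
  have hmap : Set.InjOn (fun n => n * q - t) (h.support : Set ℕ) := by
    intro x hx y hy hxy
    have h1 := (hsub x hx).1
    have h2 := (hsub y hy).1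
    simp only at hxy
    exact Nat.eq_of_mul_eq_mul_right hqpos (by omega)
  have haq : a ^ q ≠ 0 := pow_ne_zero _ ha
  by_cases hall : ∀ i ∈ f.support, i % q = i₀ % q
  · have hexp : expand F q h = X ^ t * f := by
      ext n
      rw [coeff_expand hqpos]
      split_ifs with hqn
      · rw [hh, coeff_contract hqpos.ne', Nat.div_mul_cancel hqn]
      · rw [coeff_X_pow_mul']
        split_ifs with htn
        · by_contra hne
          have h1 := hall _ (mem_support_iff.mpr (Ne.symm hne))
          apply hqn
          have h2 := Nat.div_add_mod (n - t) q
          refine ⟨(n - t) / q + 1, ?_⟩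
          rw [mul_add]
          omega
        · rfl
    have hne : X ^ t * f ≠ 0 := mul_ne_zero (pow_ne_zero _ X_ne_zero) hf
    have hrm := (le_rootMultiplicity_iff hne).mpr (hdvd.mul_left (X ^ t))
    rw [← hexp, hq, rootMultiplicity_expand_pow, ← hq] at hrm
    have hk : k + 1 ≤ rootMultiplicity (a ^ q) h :=
      lt_of_mul_lt_mul_left (Nat.lt_of_succ_le hrm) (Nat.zero_le _)
    have := lt_card_support_of_pow_dvd haq (k + 1) h hh0 hinj
      ((le_rootMultiplicity_iff hh0).mp hk)
    exact (Nat.succ_le_of_lt this).trans (Finset.card_le_card_of_injOn _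
      (fun n hn => (hsub n hn).2) hmap)
  · push Not at hall
    obtain ⟨i₁, hi₁, hne⟩ := hall
    have hd : (X - C (a ^ q)) ^ k ∣ h := by
      obtain ⟨c, hc⟩ := (pow_dvd_pow (X - C a) (Nat.le_succ (q * k))).trans hdvd
      rw [hh, hc, hq, X_sub_C_pow_char_pow_mul, mul_left_comm, mul_comm, contract_mul_expand
        (hq ▸ hqpos.ne')]
      exact dvd_mul_left _ _
    have h1 := lt_card_support_of_pow_dvd haq k h hh0 hinj hd
    have h2 : h.support.card ≤ (f.support.erase i₁).card :=
      Finset.card_le_card_of_injOn _ (fun n hn => by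
        obtain ⟨hle, hn⟩ := hsub n hn
        refine Finset.mem_coe.mpr (Finset.mem_erase.mpr ⟨?_, hn⟩)
        rintro rfl
        exact hne (hres n hle)) hmap
    rw [Finset.card_erase_of_mem hi₁] at h2
    omega

/-- Division with remainder by `q` recovers both exponents, so no two terms of the product collide.
-/
theorem card_support_expand_mul {q : ℕ} (f g : F[X]) (hg : g.natDegree < q) :
    f.support.card * g.support.card ≤ (expand F q f * g).support.card := by
  have hq : 0 < q := by omega
  have hcoeff : ∀ i j, j < q → (expand F q f * g).coeff (i * q + j) = f.coeff i * g.coeff j := by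
    intro i j hj
    rw [coeff_mul, Finset.sum_eq_single (i * q, j)]
    · rw [coeff_expand_mul hq]
    · rintro ⟨x, y⟩ hxy hne
      rw [Finset.HasAntidiagonal.mem_antidiagonal] at hxy
      simp only at hxy
      by_cases hx : q ∣ x
      · obtain ⟨z, rfl⟩ := hx
        by_cases hy : y < q
        · exfalso
          have h1 : (q * z + y) % q = y := by
            rw [Nat.mul_add_mod, Nat.mod_eq_of_lt hy]
          have h2 : (i * q + j) % q = j := by
            rw [mul_comm, Nat.mul_add_mod, Nat.mod_eq_of_lt hj]
          have h3 : y = j := by rw [← h1, hxy, h2]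
          exact hne (by ext <;> simp <;> omega)
        · rw [coeff_eq_zero_of_natDegree_lt (n := y) (by omega), mul_zero]
      · rw [coeff_expand hq, if_neg hx, zero_mul]
    · intro h
      exact absurd (by simp) h
  rw [← Finset.card_product]
  refine Finset.card_le_card_of_injOn (fun x => x.1 * q + x.2) ?_ ?_
  · rintro ⟨i, j⟩ hij
    simp only [Finset.coe_product, Set.mem_prod, Finset.mem_coe, mem_support_iff] at hij
    have hj := (le_natDegree_of_ne_zero hij.2).trans_lt hg
    simp only [Finset.mem_coe, mem_support_iff, hcoeff i j hj]
    exact mul_ne_zero hij.1 hij.2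
  · rintro ⟨i, j⟩ hij ⟨i', j'⟩ hij' h
    simp only [Finset.coe_product, Set.mem_prod, Finset.mem_coe, mem_support_iff] at hij hij' h
    have hj := (le_natDegree_of_ne_zero hij.2).trans_lt hg
    have hj' := (le_natDegree_of_ne_zero hij'.2).trans_lt hg
    have h1 := congrArg (· / q) h
    have h2 := congrArg (· % q) h
    simp only [mul_comm _ q, Nat.mul_add_div hq, Nat.mul_add_mod, Nat.div_eq_of_lt hj,
      Nat.div_eq_of_lt hj', Nat.mod_eq_of_lt hj, Nat.mod_eq_of_lt hj'] at h1 h2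
    ext <;> simp <;> omega

theorem card_support_X_sub_C_pow_le (a : F) (n : ℕ) :
    ((X - C a) ^ n).support.card ≤ n + 1 := by
  have := card_supp_le_succ_natDegree ((X - C a) ^ n)
  rwa [natDegree_pow, natDegree_X_sub_C, mul_one] at this

theorem card_support_expand_le (q : ℕ) (hq : 0 < q) (f : F[X]) :
    (expand F q f).support.card ≤ f.support.card := by
  refine Finset.card_le_card_of_injOn (fun n => n / q) ?_ ?_
  · intro n hn
    rw [Finset.mem_coe, mem_support_iff, coeff_expand hq] at hn
    split_ifs at hn with h
    · exact mem_support_iff.mpr hn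
    · exact absurd rfl hn
  · have hd : ∀ n ∈ (expand F q f).support, q ∣ n := by
      intro n hn
      rw [mem_support_iff, coeff_expand hq] at hn
      by_contra h
      rw [if_neg h] at hn
      exact hn rfl
    intro x hx y hy h
    simp only at h
    rw [← Nat.div_mul_cancel (hd x hx), h, Nat.div_mul_cancel (hd y hy)]

/-- Lower bound for the weight of a multiple of a power of `X - a` in characteristic `p`. -/
theorem weight_lower_bound {p : ℕ} [Fact p.Prime] [CharP F p] {a : F} (ha : a ≠ 0)
    (k e γ : ℕ) (f : F[X]) (hf : f ≠ 0) (hdeg : f.natDegree < p ^ (e + 1 + γ))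
    (hdvd : (X - C a) ^ (p ^ (e + 1 + γ) - p ^ (e + 1) + p ^ e * k + 1) ∣ f) :
    (k + 2) * p ^ γ ≤ f.support.card := by
  have hp : p.Prime := Fact.out
  induction γ generalizing f with
  | zero =>
    rw [pow_zero, mul_one]
    exact add_two_le_card_support ha e k f hf hdeg (by simpa using hdvd)
  | succ γ ih =>
    set q := p ^ (e + 1 + γ) with hq
    have hqp : p ^ (e + 1 + (γ + 1)) = q * (p - 1) + q := by
      rw [← add_assoc, pow_succ, ← hq, ← Nat.mul_succ, Nat.succ_eq_add_one,
        Nat.sub_add_cancel hp.one_le]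
    have hle : p ^ (e + 1) ≤ q := Nat.pow_le_pow_right hp.pos (by omega)
    have hexp : p ^ (e + 1 + (γ + 1)) - p ^ (e + 1) + p ^ e * k + 1 =
        q * (p - 1) + (q - p ^ (e + 1) + p ^ e * k + 1) := by
      rw [hqp]; omega
    -- The factor split off is `(X^q - a^q)^(p-1)`, with `p` terms; the degree bound leaves a
    -- cofactor of degree below `q`.
    rw [hexp, pow_add] at hdvd
    obtain ⟨c, hc⟩ := hdvd
    rw [mul_assoc] at hc
    set g := (X - C a) ^ (q - p ^ (e + 1) + p ^ e * k + 1) * c with hg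
    have hg0 : g ≠ 0 := by
      intro h0
      rw [h0, mul_zero] at hc
      exact hf hc
    have hmonic : ((X - C a) ^ (q * (p - 1))).Monic := (monic_X_sub_C a).pow _
    have hgdeg : g.natDegree < q := by
      rw [hc, hmonic.natDegree_mul' hg0, natDegree_pow, natDegree_X_sub_C, mul_one, hqp] at hdeg
      omega
    have h1 := ih g hg0 hgdeg (dvd_mul_right _ _)
    have h2 : p ≤ ((X - C (a ^ q)) ^ (p - 1)).support.card := by
      have hmon : ((X - C (a ^ q)) ^ (p - 1)).Monic := (monic_X_sub_C _).pow _
      have hd : ((X - C (a ^ q)) ^ (p - 1)).natDegree = p - 1 := by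
        rw [natDegree_pow, natDegree_X_sub_C, mul_one]
      have := lt_card_support_of_pow_dvd (pow_ne_zero q ha) (p - 1) ((X - C (a ^ q)) ^ (p - 1))
        hmon.ne_zero (by
          intro x hx y hy hxy
          have hx' := le_natDegree_of_mem_supp _ (Finset.mem_coe.mp hx)
          have hy' := le_natDegree_of_mem_supp _ (Finset.mem_coe.mp hy)
          rw [hd] at hx' hy'
          have hp1 := hp.one_le
          -- Exponents in `[0, p - 1]` are shifted by one to fit `[1, p]`.
          have := natCast_injOn_Icc F p (show x + 1 ∈ Set.Icc 1 p from ⟨by omega, by omega⟩)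
            (show y + 1 ∈ Set.Icc 1 p from ⟨by omega, by omega⟩) (by push_cast; rw [hxy])
          omega) dvd_rfl
      omega
    have h3 := card_support_expand_mul ((X - C (a ^ q)) ^ (p - 1)) g hgdeg
    rw [hc, hq, X_sub_C_pow_char_pow_mul, ← hq]
    calc (k + 2) * p ^ (γ + 1) = p * ((k + 2) * p ^ γ) := by ring
      _ ≤ _ := Nat.mul_le_mul h2 h1
      _ ≤ _ := h3

theorem card_support_X_sub_C_pow_char_pow_mul_le {p : ℕ} [Fact p.Prime] [CharP F p] (a : F)
    (e k : ℕ) : ((X - C a) ^ (p ^ e * k)).support.card ≤ k + 1 := by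
  have hp : p.Prime := Fact.out
  rw [X_sub_C_pow_char_pow_mul]
  exact (card_support_expand_le _ (pow_pos hp.pos _) _).trans (card_support_X_sub_C_pow_le _ _)

theorem weight_upper_bound {p : ℕ} [Fact p.Prime] [CharP F p] (a : F) (k e γ : ℕ) :
    ((X - C a) ^ (p ^ (e + 1 + γ) - p ^ (e + 1) + p ^ e * k)).support.card
      ≤ (k + 1) * p ^ γ := by
  have hp : p.Prime := Fact.out
  induction γ with
  | zero =>
    rw [add_zero, Nat.sub_self, zero_add, pow_zero, mul_one]
    exact card_support_X_sub_C_pow_char_pow_mul_le a e k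
  | succ γ ih =>
    set q := p ^ (e + 1 + γ) with hq
    have hqp : p ^ (e + 1 + (γ + 1)) = q * (p - 1) + q := by
      rw [← add_assoc, pow_succ, ← hq, ← Nat.mul_succ, Nat.succ_eq_add_one,
        Nat.sub_add_cancel hp.one_le]
    have hle : p ^ (e + 1) ≤ q := Nat.pow_le_pow_right hp.pos (by omega)
    have hexp : p ^ (e + 1 + (γ + 1)) - p ^ (e + 1) + p ^ e * k =
        q * (p - 1) + (q - p ^ (e + 1) + p ^ e * k) := by
      rw [hqp]; omega
    rw [hexp, pow_add]
    refine card_support_mul_le.trans ?_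
    have h1 := card_support_X_sub_C_pow_char_pow_mul_le (p := p) a (e + 1 + γ) (p - 1)
    rw [Nat.sub_add_cancel hp.one_le] at h1
    calc _ ≤ p * ((k + 1) * p ^ γ) := Nat.mul_le_mul h1 ih
      _ = _ := by ring

end Weights

/-! ### Symbol-pair distance against Hamming distance -/

section SymbolPair

variable {A : Type*} {n : ℕ}

open Classical in
theorem symbolPairDist_eq_card (x y : Fin n → A) :
    symbolPairDist x y =
      (Finset.univ.filter fun i => x i ≠ y i ∨ x (finRotate n i) ≠ y (finRotate n i)).card := by
  unfold symbolPairDist hammingDist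
  congr 1
  ext i
  simp only [Finset.mem_filter, Finset.mem_univ, true_and, ne_eq, Prod.mk.injEq, not_and_or]

open Classical in
-- A differing position `i` is seen by the pairs at `i` and at `i - 1`; without adjacent positions
-- in `S` these pairs are all distinct.
theorem two_mul_card_le_symbolPairDist (x y : Fin n → A) (S : Finset (Fin n))
    (hS : ∀ i ∈ S, x i ≠ y i) (hrot : ∀ i ∈ S, finRotate n i ∉ S) :
    2 * S.card ≤ symbolPairDist x y := by
  rw [symbolPairDist_eq_card]
  have hdisj : Disjoint S (S.map (finRotate n).symm.toEmbedding) := by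
    rw [Finset.disjoint_left]
    intro i hi hi'
    rw [Finset.mem_map_equiv, Equiv.symm_symm] at hi'
    exact hrot i hi hi'
  calc 2 * S.card = (S ∪ S.map (finRotate n).symm.toEmbedding).card := by
        rw [Finset.card_union_of_disjoint hdisj, Finset.card_map, two_mul]
    _ ≤ _ := by
        refine Finset.card_le_card fun i hi => ?_
        rw [Finset.mem_union, Finset.mem_map_equiv, Equiv.symm_symm] at hi
        rw [Finset.mem_filter]
        exact ⟨Finset.mem_univ _, hi.imp (hS _) (hS _)⟩

open Classical in
theorem symbolPairDist_le_two_mul_card (x y : Fin n → A) (S : Finset (Fin n))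
    (hS : ∀ i, x i ≠ y i → i ∈ S) : symbolPairDist x y ≤ 2 * S.card := by
  rw [symbolPairDist_eq_card]
  calc _ ≤ (S ∪ S.map (finRotate n).symm.toEmbedding).card := by
        refine Finset.card_le_card fun i hi => ?_
        rw [Finset.mem_filter] at hi
        rw [Finset.mem_union, Finset.mem_map_equiv, Equiv.symm_symm]
        exact hi.2.imp (hS _) (hS _)
    _ ≤ _ := by
        refine (Finset.card_union_le _ _).trans ?_
        rw [Finset.card_map, two_mul]

/-- Parity flips even at the wrap-around, because the length is even. -/
theorem val_finRotate_mod_two {N : ℕ} (i : Fin (2 * N)) :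
    (finRotate (2 * N) i : ℕ) % 2 = (i + 1) % 2 := by
  have := i.neZero
  have h1 : 1 % (2 * N) = 1 := Nat.mod_eq_of_lt (by have := i.2; omega)
  rw [finRotate_apply, Fin.val_add, Nat.mod_mod_of_dvd _ (dvd_mul_right 2 N), Fin.val_one', h1]

end SymbolPair

/-! ### The ring `F + uF + vF + uvF` and its ideal `uvF` -/

namespace UVRing

variable (F : Type*) [Field F]

theorem u_mul_u : u F * u F = 0 := by
  rw [u, ← map_mul, ← pow_two]
  exact Ideal.Quotient.eq_zero_iff_mem.mpr (Ideal.subset_span (by simp))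

theorem v_mul_v : v F * v F = 0 := by
  rw [v, ← map_mul, ← pow_two]
  exact Ideal.Quotient.eq_zero_iff_mem.mpr (Ideal.subset_span (by simp))

/-- The map that sends `u` and `v` to zero. -/
noncomputable def aug : UVRing F →ₐ[F] F :=
  Ideal.Quotient.liftₐ _ (MvPolynomial.aeval (fun _ => (0 : F))) (by
    intro a ha
    have : (Ideal.span {MvPolynomial.X 0 ^ 2, MvPolynomial.X 1 ^ 2,
        MvPolynomial.X 0 * MvPolynomial.X 1 - MvPolynomial.X 1 * MvPolynomial.X 0} :
        Ideal (MvPolynomial (Fin 2) F)) ≤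
        RingHom.ker (MvPolynomial.aeval (fun _ : Fin 2 => (0 : F))) := by
      rw [Ideal.span_le]
      rintro x (rfl | rfl | rfl) <;> simp [RingHom.mem_ker]
    exact this ha)

theorem u_mul_v_ne_zero : u F * v F ≠ 0 := by
  intro h
  rw [u, v, ← map_mul] at h
  have hmem := Ideal.Quotient.eq_zero_iff_mem.mp h
  have hle : (Ideal.span {MvPolynomial.X 0 ^ 2, MvPolynomial.X 1 ^ 2,
      MvPolynomial.X 0 * MvPolynomial.X 1 - MvPolynomial.X 1 * MvPolynomial.X 0} :
      Ideal (MvPolynomial (Fin 2) F)) ≤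
      -- Iterated dual numbers model the relations, with `u` and `v` the two infinitesimals, and
      -- there `uv` is nonzero.
      RingHom.ker (MvPolynomial.aeval (R := F)
        ![(TrivSqZeroExt.inl DualNumber.eps : DualNumber (DualNumber F)),
          DualNumber.eps]) := by
    rw [Ideal.span_le]
    rintro x (rfl | rfl | rfl)
    · simp [RingHom.mem_ker, pow_two, ← TrivSqZeroExt.inl_mul]
    · simp [RingHom.mem_ker, pow_two]
    · simp [mul_comm]
  have h1 := RingHom.mem_ker.mp (hle hmem)
  have h2 := congrArg (fun z => TrivSqZeroExt.snd (TrivSqZeroExt.snd z)) h1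
  simp at h2

theorem u_mul_v_mul (r : UVRing F) :
    u F * v F * r = u F * v F * algebraMap F (UVRing F) (aug F r) := by
  obtain ⟨P, rfl⟩ := Ideal.Quotient.mk_surjective r
  have haug : ∀ P, aug F (Ideal.Quotient.mk _ P) = MvPolynomial.aeval (fun _ => (0 : F)) P :=
    fun P => Ideal.Quotient.liftₐ_apply _ _ _ _
  rw [haug]
  induction P using MvPolynomial.induction_on with
  | C a =>
    simp
    rfl
  | add P Q hP hQ => rw [map_add, mul_add, hP, hQ, map_add, map_add, mul_add]
  | mul_X P i hP =>
    rw [map_mul, ← mul_assoc, mul_right_comm, map_mul, MvPolynomial.aeval_X, mul_zero, map_zero,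
      mul_zero]
    have : u F * v F * Ideal.Quotient.mk _ (MvPolynomial.X i) = 0 := by
      fin_cases i
      · change u F * v F * u F = 0
        rw [mul_right_comm, u_mul_u, zero_mul]
      · change u F * v F * v F = 0
        rw [mul_assoc, v_mul_v, mul_zero]
    rw [this, zero_mul]

variable {F}

theorem algebraMap_mul_uv_injective :
    Function.Injective fun t : F => algebraMap F (UVRing F) t * (u F * v F) := by
  intro t t' h
  simp only at h
  rw [← sub_eq_zero, ← sub_mul, ← map_sub] at h
  by_contra hne
  have hne' : t - t' ≠ 0 := sub_ne_zero.mpr hne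
  apply u_mul_v_ne_zero F
  calc u F * v F = algebraMap F (UVRing F) ((t - t')⁻¹ * (t - t')) * (u F * v F) := by
        rw [inv_mul_cancel₀ hne', map_one, one_mul]
    _ = 0 := by rw [map_mul, mul_assoc, h, mul_zero]

/-- Behind a factor `uv`, polynomials over the ring may be replaced by polynomials over the field.
-/
theorem C_uv_mul (g : (UVRing F)[X]) :
    C (u F * v F) * g =
      C (u F * v F) * (g.map (aug F : UVRing F →+* F)).map (algebraMap F (UVRing F)) := by
  ext n
  rw [coeff_C_mul, coeff_C_mul, coeff_map, coeff_map, u_mul_v_mul]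
  rfl

end UVRing

/-! ### Words as polynomials of degree below `n` -/

section WordPolynomial

variable {A : Type*} [CommRing A] {n : ℕ}

theorem coeff_sum_C_mul_X_pow (c : Fin n → A) (i : Fin n) :
    (∑ j : Fin n, C (c j) * X ^ (j : ℕ) : A[X]).coeff i = c i := by
  rw [finsetSum_coeff, Finset.sum_eq_single i]
  · simp
  · intro j _ hj
    rw [coeff_C_mul, coeff_X_pow, if_neg (fun h => hj (Fin.ext h.symm)), mul_zero]
  · simp

theorem degree_sum_C_mul_X_pow_lt (c : Fin n → A) :
    (∑ j : Fin n, C (c j) * X ^ (j : ℕ) : A[X]).degree < n := by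
  refine (degree_sum_le _ _).trans_lt ((Finset.sup_lt_iff (WithBot.bot_lt_coe n)).mpr ?_)
  intro j _
  exact (degree_C_mul_X_pow_le _ _).trans_lt (WithBot.coe_lt_coe.mpr j.2)

theorem mk_eq_wordClass {a : A} (f : A[X]) (hf : f.degree < n) :
    (Ideal.Quotient.mk _ f : ConstaRing A n a) = wordClass a fun i : Fin n => f.coeff i := by
  rw [wordClass]
  congr 1
  ext k
  by_cases hk : k < n
  · exact (coeff_sum_C_mul_X_pow (fun i : Fin n => f.coeff i) ⟨k, hk⟩).symm
  · have hk' : (n : WithBot ℕ) ≤ k := by exact_mod_cast not_lt.mp hk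
    rw [coeff_eq_zero_of_degree_lt (hf.trans_le hk'),
      coeff_eq_zero_of_degree_lt ((degree_sum_C_mul_X_pow_lt _).trans_le hk')]

theorem wordClass_injective [Nontrivial A] (hn : 0 < n) (a : A) :
    Function.Injective (wordClass a : (Fin n → A) → ConstaRing A n a) := by
  intro c d h
  rw [wordClass, wordClass, Ideal.Quotient.eq, Ideal.mem_span_singleton] at h
  have hmonic : (X ^ n - C a : A[X]).Monic := monic_X_pow_sub_C a hn.ne'
  have hdeg : ((∑ j : Fin n, C (c j) * X ^ (j : ℕ)) - ∑ j : Fin n, C (d j) * X ^ (j : ℕ) :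
      A[X]).degree < (X ^ n - C a : A[X]).degree := by
    rw [degree_X_pow_sub_C hn]
    exact (degree_sub_le _ _).trans_lt
      (max_lt (degree_sum_C_mul_X_pow_lt c) (degree_sum_C_mul_X_pow_lt d))
  have h0 := sub_eq_zero.mp ((modByMonic_eq_zero_iff_dvd hmonic).mpr h ▸
    ((modByMonic_eq_self_iff hmonic).mpr hdeg).symm)
  funext i
  rw [← coeff_sum_C_mul_X_pow c i, h0, coeff_sum_C_mul_X_pow]

end WordPolynomial

/-! ### The code as `uv` times a code over `F` -/

section Code

variable {F : Type*} [Field F] {p m s : ℕ}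

/-- The word with entries `uv` times the coefficients of `f`. -/
noncomputable def uvWord (n : ℕ) (f : F[X]) : Fin n → UVRing F :=
  fun i => algebraMap F (UVRing F) (f.coeff i) * (UVRing.u F * UVRing.v F)

theorem uvWord_ne_iff {n : ℕ} (f g : F[X]) (i : Fin n) :
    uvWord n f i ≠ uvWord n g i ↔ (f - g).coeff i ≠ 0 := by
  rw [coeff_sub, sub_ne_zero]
  exact UVRing.algebraMap_mul_uv_injective.ne_iff

theorem wordClass_uvWord {n : ℕ} (a : UVRing F) (f : F[X]) (hf : f.degree < n) :
    wordClass a (uvWord n f) =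
      (Ideal.Quotient.mk _ (C (UVRing.u F * UVRing.v F) * f.map (algebraMap F (UVRing F))) :
        ConstaRing (UVRing F) n a) := by
  refine Eq.trans ?_ (mk_eq_wordClass (a := a) _ ?_).symm
  · congr 1
    funext i
    rw [coeff_C_mul, coeff_map, uvWord, mul_comm]
  · refine (degree_lt_iff_coeff_zero _ _).mpr fun k hk => ?_
    rw [coeff_C_mul, coeff_map, (degree_lt_iff_coeff_zero _ _).mp hf k hk, map_zero, mul_zero]

theorem alphaZero_pow [Finite F] (hm : 0 < m) (hF : Nat.card F = p ^ m) (α₁ : F) :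
    alphaZero p m s α₁ ^ p ^ s = α₁ := by
  have := Fintype.ofFinite F
  rw [Nat.card_eq_fintype_card] at hF
  -- The total exponent is a multiple of `m`, so it gives a power of the map `x ↦ x ^ card F`, which
  -- is the identity.
  have hexp : m - s % m + s = m * (s / m + 1) := by
    have h1 := Nat.div_add_mod s m
    have h2 := Nat.mod_lt s hm
    rw [mul_add]
    omega
  rw [alphaZero, ← pow_mul, ← pow_add, hexp, pow_mul, ← hF, FiniteField.pow_card_pow]

theorem alphaZero_ne_zero {α₁ : F} (h : α₁ ≠ 0) : alphaZero p m s α₁ ≠ 0 := pow_ne_zero _ h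

theorem X_sq_sub_C_pow_char_pow [Fact p.Prime] {R : Type*} [CommRing R] [CharP R p] (a : R) :
    (X ^ 2 - C a : R[X]) ^ p ^ s = X ^ (2 * p ^ s) - C (a ^ p ^ s) := by
  rw [sub_pow_char_pow, C_pow, pow_mul]

theorem uv_mul_uvAlpha (α₁ α₃ α₄ : F) :
    UVRing.u F * UVRing.v F * uvAlpha α₁ α₃ α₄ =
      UVRing.u F * UVRing.v F * algebraMap F (UVRing F) α₁ := by
  have hv := UVRing.v_mul_v F
  rw [uvAlpha]
  linear_combination (UVRing.u F * algebraMap F (UVRing F) α₃ +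
    UVRing.u F * UVRing.u F * algebraMap F (UVRing F) α₄) * hv

theorem u_mul_uvAlpha (α₁ α₃ α₄ : F) :
    UVRing.u F * uvAlpha α₁ α₃ α₄ = UVRing.u F * algebraMap F (UVRing F) α₁ +
      UVRing.u F * UVRing.v F * algebraMap F (UVRing F) α₃ := by
  have hu := UVRing.u_mul_u F
  rw [uvAlpha]
  linear_combination (UVRing.v F * algebraMap F (UVRing F) α₄) * hu

instance : Nontrivial (UVRing F) :=
  nontrivial_of_ne _ _ (UVRing.u_mul_v_ne_zero F)

/-- In `R[x] / ⟨x ^ (2 p ^ s) - α⟩` one has `u (x² - α₀) ^ (p ^ s) = α₃ uv`. -/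
theorem C_u_mul_pow_eq [Finite F] [Fact p.Prime] [CharP F p] (hm : 0 < m)
    (hF : Nat.card F = p ^ m) (α₁ α₃ α₄ : F) :
    C (UVRing.u F) * (X ^ 2 - C (algebraMap F (UVRing F) (alphaZero p m s α₁))) ^ p ^ s =
      C (UVRing.u F) * (X ^ (2 * p ^ s) - C (uvAlpha α₁ α₃ α₄)) +
        C (UVRing.u F * UVRing.v F) * C (algebraMap F (UVRing F) α₃) := by
  have : CharP (UVRing F) p := charP_of_injective_algebraMap (algebraMap F (UVRing F)).injective p
  rw [X_sq_sub_C_pow_char_pow, ← map_pow, alphaZero_pow hm hF, mul_sub, mul_sub, ← C_mul, ← C_mul,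
    ← C_mul, u_mul_uvAlpha, C_add]
  ring

theorem C_uv_mul_modulus (n : ℕ) (α₁ α₃ α₄ : F) :
    C (UVRing.u F * UVRing.v F) * (X ^ n - C α₁ : F[X]).map (algebraMap F (UVRing F)) =
      C (UVRing.u F * UVRing.v F) * (X ^ n - C (uvAlpha α₁ α₃ α₄)) := by
  rw [Polynomial.map_sub, Polynomial.map_pow, map_X, map_C, mul_sub, mul_sub, ← C_mul, ← C_mul,
    uv_mul_uvAlpha]

theorem mem_idealCode_iff [Finite F] [Fact p.Prime] [CharP F p] (hm : 0 < m)
    (hF : Nat.card F = p ^ m) (α₁ α₃ α₄ : F) (hα₃ : α₃ ≠ 0) (j : ℕ) (hj : j ≤ p ^ s)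
    (c : Fin (2 * p ^ s) → UVRing F) :
    c ∈ idealCode (typeBIdeal p m s α₁ α₃ α₄ (p ^ s + j)) ↔
      ∃ f : F[X], f.degree < (2 * p ^ s : ℕ) ∧ (X ^ 2 - C (alphaZero p m s α₁)) ^ j ∣ f ∧
        c = uvWord (2 * p ^ s) f := by
  have hp : p.Prime := Fact.out
  set φ := algebraMap F (UVRing F) with hφ
  set a := alphaZero p m s α₁ with ha
  have hn : 0 < 2 * p ^ s := Nat.mul_pos two_pos (pow_pos hp.pos _)
  have hQmap : ∀ k, (X ^ 2 - C (φ a)) ^ k = ((X ^ 2 - C a : F[X]) ^ k).map φ := by simp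
  -- Modulo `x^n - α` the generator is `α₃ uv (x² - α₀)^j`.
  have hgen : ∃ k, C (UVRing.u F) * (X ^ 2 - C (φ a)) ^ (p ^ s + j) =
      (X ^ (2 * p ^ s) - C (uvAlpha α₁ α₃ α₄)) * k + C (UVRing.u F * UVRing.v F) *
        (C α₃ * (X ^ 2 - C a : F[X]) ^ j).map φ := by
    refine ⟨C (UVRing.u F) * (X ^ 2 - C (φ a)) ^ j, ?_⟩
    rw [pow_add, ← mul_assoc, C_u_mul_pow_eq hm hF α₁ α₃ α₄, Polynomial.map_mul, map_C, hQmap j]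
    ring
  obtain ⟨k, hk⟩ := hgen
  have hmkP : ∀ z, (Ideal.Quotient.mk _ ((X ^ (2 * p ^ s) - C (uvAlpha α₁ α₃ α₄)) * z) :
      ConstaRing (UVRing F) (2 * p ^ s) (uvAlpha α₁ α₃ α₄)) = 0 := fun z =>
    Ideal.Quotient.eq_zero_iff_mem.mpr (Ideal.mul_mem_right _ _ (Ideal.subset_span rfl))
  rw [idealCode, Set.mem_ofPred_eq, typeBIdeal, ← ha, ← hφ, hk, Ideal.mem_span_singleton', map_add,
    hmkP, zero_add]
  constructor
  · rintro ⟨z, hz⟩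
    obtain ⟨g, rfl⟩ := Ideal.Quotient.mk_surjective z
    set h : F[X] := (g.map (UVRing.aug F : UVRing F →+* F)) * (C α₃ * (X ^ 2 - C a) ^ j) with hh
    have hmonic : (X ^ (2 * p ^ s) - C α₁ : F[X]).Monic := monic_X_pow_sub_C _ hn.ne'
    set f := h %ₘ (X ^ (2 * p ^ s) - C α₁) with hf
    have hdeg : f.degree < (2 * p ^ s : ℕ) := by
      have := degree_modByMonic_lt h hmonic
      rwa [degree_X_pow_sub_C hn] at this
    refine ⟨f, hdeg, ?_, wordClass_injective hn (uvAlpha α₁ α₃ α₄) ?_⟩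
    · have hfh : f = h - (X ^ (2 * p ^ s) - C α₁) * (h /ₘ (X ^ (2 * p ^ s) - C α₁)) := by
        rw [hf]
        exact modByMonic_eq_sub_mul_div _ _
      rw [hfh]
      refine dvd_sub (Dvd.intro_left _ (mul_assoc _ _ _)) (Dvd.dvd.mul_right ?_ _)
      -- Reduction preserves divisibility, as `x^n - α₁ = (x² - α₀)^(p^s)` and `j ≤ p^s`.
      rw [← alphaZero_pow (s := s) hm hF α₁, ← X_sq_sub_C_pow_char_pow]
      exact pow_dvd_pow _ hj
    · rw [← hz, wordClass_uvWord _ _ hdeg, ← map_mul]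
      have e1 : g * (C (UVRing.u F * UVRing.v F) * (C α₃ * (X ^ 2 - C a : F[X]) ^ j).map φ) =
          C (UVRing.u F * UVRing.v F) * h.map φ := by
        rw [hh, Polynomial.map_mul (p := g.map _), ← mul_assoc (C _), ← UVRing.C_uv_mul]
        ring
      have e2 : C (UVRing.u F * UVRing.v F) * h.map φ =
          (X ^ (2 * p ^ s) - C (uvAlpha α₁ α₃ α₄)) * (C (UVRing.u F * UVRing.v F) *
            (h /ₘ (X ^ (2 * p ^ s) - C α₁)).map φ) + C (UVRing.u F * UVRing.v F) * f.map φ := by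
        conv_lhs => rw [← modByMonic_add_div h (X ^ (2 * p ^ s) - C α₁), ← hf, Polynomial.map_add,
          Polynomial.map_mul, mul_add, ← mul_assoc, C_uv_mul_modulus _ α₁ α₃ α₄]
        ring
      rw [e1, e2, map_add, hmkP, zero_add]
  · rintro ⟨f, hdeg, ⟨g, rfl⟩, rfl⟩
    refine ⟨Ideal.Quotient.mk _ ((C α₃⁻¹ * g).map φ), ?_⟩
    rw [wordClass_uvWord _ _ hdeg, ← map_mul]
    congr 1
    have h1 : (X ^ 2 - C a) ^ j * g = (C α₃⁻¹ * g) * (C α₃ * (X ^ 2 - C a) ^ j) := by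
      have : (C α₃⁻¹ * C α₃ : F[X]) = 1 := by rw [← C_mul, inv_mul_cancel₀ hα₃, C_1]
      linear_combination (-(X ^ 2 - C a) ^ j * g) * this
    rw [h1, Polynomial.map_mul (p := C α₃⁻¹ * g)]
    ring

theorem typeBIdeal_antitone (α₁ α₃ α₄ : F) {k l : ℕ} (h : k ≤ l) :
    typeBIdeal p m s α₁ α₃ α₄ l ≤ typeBIdeal p m s α₁ α₃ α₄ k := by
  rw [typeBIdeal, typeBIdeal, Ideal.span_singleton_le_span_singleton]
  exact map_dvd _ (mul_dvd_mul_left _ (pow_dvd_pow _ h))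

end Code

/-! ### Even and odd parts, and pair weights -/

section Distance

variable {F : Type*} [Field F] {p m s : ℕ}

theorem symbolPairDist_uvWord_lower {N : ℕ} (f g h : F[X]) (r : ℕ) (hr : r < 2)
    (hh : ∀ n, h.coeff n = (f - g).coeff (2 * n + r))
    (hdeg : (f - g).degree < (2 * N : ℕ)) :
    2 * h.support.card ≤ symbolPairDist (uvWord (2 * N) f) (uvWord (2 * N) g) := by
  classical
  set S : Finset (Fin (2 * N)) :=
    Finset.univ.filter fun i => (i : ℕ) % 2 = r ∧ (f - g).coeff i ≠ 0 with hS
  have hcard : h.support.card ≤ S.card := by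
    have hlt : ∀ n ∈ h.support, 2 * n + r < 2 * N := by
      intro n hn
      rw [mem_support_iff, hh] at hn
      by_contra hge
      exact hn ((degree_lt_iff_coeff_zero _ _).mp hdeg _ (not_lt.mp hge))
    refine Finset.card_le_card_of_surjOn (fun i : Fin (2 * N) => (i : ℕ) / 2) ?_
    intro n hn
    refine ⟨⟨2 * n + r, hlt n hn⟩, ?_, by simp only; omega⟩
    rw [Finset.mem_coe, mem_support_iff, hh] at hn
    rw [hS, Finset.mem_coe, Finset.mem_filter]
    exact ⟨Finset.mem_univ _, by simp only; omega, hn⟩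
  refine (Nat.mul_le_mul_left 2 hcard).trans (two_mul_card_le_symbolPairDist _ _ S ?_ ?_)
  · intro i hi
    rw [hS, Finset.mem_filter] at hi
    exact (uvWord_ne_iff f g i).mpr hi.2.2
  · intro i hi hi'
    rw [hS, Finset.mem_filter] at hi hi'
    have h1 := val_finRotate_mod_two i
    have h2 := hi.2.1
    have h3 := hi'.2.1
    omega

/-- `contract 2` is linear over polynomials in `X²`, so it turns the factor `(X² - a)^j` into `(X -
a)^j`. For the odd part it is applied to `X f`; the extra factor `X` is coprime to `X - a` because
`a ≠ 0`. -/
theorem exists_even_or_odd_part (a : F) (j N : ℕ) (f : F[X]) (hf : f ≠ 0) (ha : a ≠ 0)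
    (hdeg : f.degree < (2 * N : ℕ)) (hdvd : (X ^ 2 - C a) ^ j ∣ f) :
    ∃ (h : F[X]) (r : ℕ), r < 2 ∧ h ≠ 0 ∧ h.natDegree < N ∧ (X - C a) ^ j ∣ h ∧
      ∀ n, h.coeff n = f.coeff (2 * n + r) := by
  have hexp : (X ^ 2 - C a) ^ j = expand F 2 ((X - C a) ^ j) := by simp
  have hcontract : ∀ g : F[X], (X ^ 2 - C a) ^ j ∣ g → (X - C a) ^ j ∣ contract 2 g := by
    rintro g ⟨c, rfl⟩
    rw [hexp, mul_comm, contract_mul_expand two_ne_zero]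
    exact dvd_mul_left _ _
  have hnat : ∀ (h : F[X]) (r : ℕ), h ≠ 0 → (∀ n, h.coeff n = f.coeff (2 * n + r)) →
      h.natDegree < N := by
    intro h r h0 hc
    have hl : h.coeff h.natDegree ≠ 0 := leadingCoeff_ne_zero.mpr h0
    rw [hc] at hl
    by_contra hge
    exact hl ((degree_lt_iff_coeff_zero _ _).mp hdeg _ (by omega))
  have he : ∀ n, (contract 2 f).coeff n = f.coeff (2 * n + 0) := fun n => by
    rw [coeff_contract two_ne_zero, mul_comm, add_zero]
  have hX : X * divX (contract 2 (X * f)) = contract 2 (X * f) := by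
    have := divX_mul_X_add (contract 2 (X * f))
    rwa [coeff_contract two_ne_zero, zero_mul, coeff_X_mul_zero, C_0, add_zero, mul_comm] at this
  have ho : ∀ n, (divX (contract 2 (X * f))).coeff n = f.coeff (2 * n + 1) := fun n => by
    rw [coeff_divX, coeff_contract two_ne_zero, show (n + 1) * 2 = 2 * n + 1 + 1 by ring,
      coeff_X_mul]
  by_cases h0 : contract 2 f = 0
  · have h1 : divX (contract 2 (X * f)) ≠ 0 := by
      intro h1
      apply hf
      ext n
      obtain ⟨k, rfl | rfl⟩ := Nat.even_or_odd' n
      · have := he k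
        rw [h0, coeff_zero, add_zero] at this
        rw [← this, coeff_zero]
      · rw [← ho, h1, coeff_zero, coeff_zero]
    refine ⟨_, 1, one_lt_two, h1, hnat _ 1 h1 ho, ?_, ho⟩
    have hcop : IsCoprime ((X - C a) ^ j) X := by
      have := (isCoprime_X_sub_C_of_isUnit_sub (R := F) (a := a) (b := 0) (by simpa using ha))
      rw [C_0, sub_zero] at this
      exact this.pow_left
    refine hcop.dvd_of_dvd_mul_left ?_
    rw [hX]
    exact hcontract _ (hdvd.mul_left X)
  · exact ⟨_, 0, two_pos, h0, hnat _ 0 h0 he, hcontract f hdvd, he⟩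

theorem symbolPairDist_uvWord_expand_zero_le {N : ℕ} (h : F[X]) :
    symbolPairDist (uvWord (2 * N) (expand F 2 h)) (uvWord (2 * N) 0) ≤ 2 * h.support.card := by
  classical
  set S : Finset (Fin (2 * N)) :=
    Finset.univ.filter fun i => (expand F 2 h).coeff i ≠ 0 with hS
  have hcard : S.card ≤ (expand F 2 h).support.card :=
    Finset.card_le_card_of_injOn (fun i => (i : ℕ))
      (fun i hi => mem_support_iff.mpr (Finset.mem_filter.mp hi).2) Fin.val_injective.injOn
  refine (symbolPairDist_le_two_mul_card _ _ S fun i hi => ?_).trans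
    (Nat.mul_le_mul_left 2 (hcard.trans (card_support_expand_le 2 two_pos h)))
  rw [uvWord_ne_iff, sub_zero] at hi
  exact Finset.mem_filter.mpr ⟨Finset.mem_univ _, hi⟩

theorem two_le_symbolPairDist {A : Type*} {N : ℕ} (x y : Fin (2 * N) → A) (h : x ≠ y) :
    2 ≤ symbolPairDist x y := by
  obtain ⟨i, hi⟩ := Function.ne_iff.mp h
  refine two_mul_card_le_symbolPairDist x y {i} (fun k hk => ?_) fun k hk hk' => ?_
  · rwa [Finset.mem_singleton.mp hk]
  · rw [Finset.mem_singleton] at hk hk'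
    have := val_finRotate_mod_two k
    rw [hk', hk] at this
    omega

end Distance

/-! ### The distance formula -/

theorem theorem15 {F : Type*} [Field F] [Finite F] (p m s : ℕ) (hp : p.Prime) (hp2 : p ≠ 2)
    (hm : 0 < m) (hs : 0 < s) (hF : Nat.card F = p ^ m) (α₁ α₃ α₄ : F)
    (hα₁ : α₁ ≠ 0) (hα₃ : α₃ ≠ 0) (hα : ¬ IsSquare (uvAlpha α₁ α₃ α₄))
    (ℓ : ℕ) (hℓ : ℓ ≤ 2 * p ^ s - 1) :
    (ℓ ≤ p ^ s → codeSymbolPairDist (idealCode (typeBIdeal p m s α₁ α₃ α₄ ℓ)) = 2) ∧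
    (∀ Γ γ : ℕ, 1 ≤ Γ → Γ ≤ p - 1 → γ ≤ s - 1 →
      2 * p ^ s - p ^ (s - γ) + (Γ - 1) * p ^ (s - γ - 1) + 1 ≤ ℓ →
      ℓ ≤ 2 * p ^ s - p ^ (s - γ) + Γ * p ^ (s - γ - 1) →
      codeSymbolPairDist (idealCode (typeBIdeal p m s α₁ α₃ α₄ ℓ)) = 2 * (Γ + 1) * p ^ γ) := by
  have : Fact p.Prime := ⟨hp⟩
  have := Fintype.ofFinite F
  have : CharP F p :=
    charP_of_card_eq_prime_pow (f := m) (by rw [← Nat.card_eq_fintype_card, hF])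
  have hN : 0 < p ^ s := pow_pos hp.pos s
  refine ⟨fun hle => ?_, fun Γ γ hΓ1 hΓ2 hγ hlow hup => ?_⟩
  · refine IsLeast.csInf_eq ⟨?_, ?_⟩
    · have hmono : idealCode (typeBIdeal p m s α₁ α₃ α₄ (p ^ s + 0)) ⊆
          idealCode (typeBIdeal p m s α₁ α₃ α₄ ℓ) :=
        fun c hc => typeBIdeal_antitone α₁ α₃ α₄ (by omega) hc
      have hdeg : (1 : F[X]).degree < (2 * p ^ s : ℕ) := by
        rw [degree_one]
        exact Nat.cast_pos.mpr (by omega)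
      have h1 : uvWord (2 * p ^ s) 1 ∈ idealCode (typeBIdeal p m s α₁ α₃ α₄ ℓ) :=
        hmono ((mem_idealCode_iff hm hF α₁ α₃ α₄ hα₃ 0 (Nat.zero_le _) _).mpr
          ⟨1, hdeg, by simp, rfl⟩)
      have h0 : uvWord (2 * p ^ s) 0 ∈ idealCode (typeBIdeal p m s α₁ α₃ α₄ ℓ) :=
        hmono ((mem_idealCode_iff hm hF α₁ α₃ α₄ hα₃ 0 (Nat.zero_le _) _).mpr
          ⟨0, degree_zero (R := F) ▸ WithBot.bot_lt_coe _, dvd_zero _, rfl⟩)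
      have hne : uvWord (2 * p ^ s) (1 : F[X]) ≠ uvWord (2 * p ^ s) 0 :=
        Function.ne_iff.mpr ⟨⟨0, by omega⟩, (uvWord_ne_iff _ _ _).mpr (by simp)⟩
      refine ⟨_, h1, _, h0, hne, le_antisymm ?_ (two_le_symbolPairDist _ _ hne)⟩
      have := symbolPairDist_uvWord_expand_zero_le (N := p ^ s) (1 : F[X])
      rw [map_one] at this
      refine this.trans ?_
      rw [← C_1, support_C one_ne_zero, Finset.card_singleton]
    · rintro d ⟨x, -, y, -, hxy, rfl⟩
      exact two_le_symbolPairDist x y hxy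
  · obtain ⟨e, rfl⟩ : ∃ e, s = e + 1 + γ := ⟨s - γ - 1, by omega⟩
    obtain ⟨k, rfl⟩ : ∃ k, Γ = k + 1 := ⟨Γ - 1, by omega⟩
    rw [show e + 1 + γ - γ = e + 1 by omega, Nat.add_sub_cancel] at hlow hup
    rw [Nat.add_sub_cancel] at hlow
    have hle : p ^ (e + 1) ≤ p ^ (e + 1 + γ) := Nat.pow_le_pow_right hp.pos (by omega)
    set N := p ^ (e + 1 + γ) with hNdef
    set a := alphaZero p m (e + 1 + γ) α₁ with ha
    have ha0 : a ≠ 0 := alphaZero_ne_zero hα₁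
    -- The lower limit of the range exceeds `N`, since `p^(e+1) ≤ N`.
    obtain ⟨j, rfl⟩ : ∃ j, ℓ = N + j := ⟨ℓ - N, by omega⟩
    rw [mul_comm (k + 1)] at hup
    rw [mul_comm k] at hlow
    have hmem := mem_idealCode_iff (s := e + 1 + γ) hm hF α₁ α₃ α₄ hα₃ j (by omega)
    have hlower : ∀ x ∈ idealCode (typeBIdeal p m (e + 1 + γ) α₁ α₃ α₄ (N + j)),
        ∀ y ∈ idealCode (typeBIdeal p m (e + 1 + γ) α₁ α₃ α₄ (N + j)), x ≠ y →
          2 * (k + 1 + 1) * p ^ γ ≤ symbolPairDist x y := by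
      intro x hx y hy hxy
      obtain ⟨f, hf, hfd, rfl⟩ := (hmem x).mp hx
      obtain ⟨g, hg, hgd, rfl⟩ := (hmem y).mp hy
      have hfg : f - g ≠ 0 := by
        intro h
        exact hxy (by rw [sub_eq_zero.mp h])
      have hdeg : (f - g).degree < (2 * N : ℕ) :=
        (degree_sub_le _ _).trans_lt (max_lt hf hg)
      obtain ⟨h, r, hr, hh0, hhdeg, hhd, hhc⟩ :=
        exists_even_or_odd_part a j N (f - g) hfg ha0 hdeg (dvd_sub hfd hgd)
      have hw := weight_lower_bound ha0 k e γ h hh0 hhdeg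
        ((pow_dvd_pow _ (by omega)).trans hhd)
      have := symbolPairDist_uvWord_lower f g h r hr hhc hdeg
      rw [mul_assoc]
      exact (Nat.mul_le_mul_left 2 hw).trans this
    refine IsLeast.csInf_eq ⟨?_, fun d ⟨x, hx, y, hy, hxy, hd⟩ => hd ▸ hlower x hx y hy hxy⟩
    -- The largest `j` in the range: `(X - a)^t` serves every `j` there and attains the bound.
    set t := N - p ^ (e + 1) + p ^ e * (k + 1) with ht
    set h := (X - C a) ^ t with hh
    have htN : t < N := by
      have h1 : p ^ e * (k + 1) < p ^ (e + 1) := by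
        rw [pow_succ]
        exact Nat.mul_lt_mul_of_pos_left (by omega) (pow_pos hp.pos e)
      omega
    have hmonic : (expand F 2 h).Monic := ((monic_X_sub_C a).pow t).expand two_pos
    have hdeg : (expand F 2 h).degree < (2 * N : ℕ) := by
      rw [degree_eq_natDegree hmonic.ne_zero, natDegree_expand, hh, natDegree_pow,
        natDegree_X_sub_C]
      exact Nat.cast_lt.mpr (by omega)
    have hdvd : (X ^ 2 - C a) ^ j ∣ expand F 2 h := by
      rw [hh, map_pow, map_sub, expand_X, expand_C]
      exact pow_dvd_pow _ (by omega)
    have h1 := (hmem (uvWord _ (expand F 2 h))).mpr ⟨_, hdeg, hdvd, rfl⟩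
    have h0 := (hmem (uvWord _ 0)).mpr ⟨0, degree_zero (R := F) ▸ WithBot.bot_lt_coe _, dvd_zero _, rfl⟩
    have hne : uvWord (2 * N) (expand F 2 h) ≠ uvWord (2 * N) 0 :=
      -- The constant term `(-a)^t` is nonzero.
      Function.ne_iff.mpr ⟨⟨0, by omega⟩, (uvWord_ne_iff _ _ _).mpr (by
        simp [coeff_zero_eq_eval_zero, hh, ha0])⟩
    refine ⟨_, h1, _, h0, hne, le_antisymm ?_ (hlower _ h1 _ h0 hne)⟩
    rw [mul_assoc]
    exact (symbolPairDist_uvWord_expand_zero_le h).trans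
      (Nat.mul_le_mul_left 2 (weight_upper_bound a (k + 1) e γ))
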